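/- Let $\mathbb K$ be a field and let $G$ be a simple graph on $[n]=\{1,\dots,n\}$. Its binomial edge ideal is $J_G=(x_iy_j-x_jy_i \mid \{i,j\}\in E(G))\subset S=\mathbb K[x_1,\dots,x_n,y_1,\dots,y_n]$. Let $\mathrm{in}(J_G)$ be its initial ideal, generated by the leading monomials of its nonzero elements, for the lexicographic order with $x_1>\dots>x_n>y_1>\dots>y_n$. Let $\mathrm{gin}(J_G)$ be its multigraded generic initial ideal for the same order and for the grading $\deg x_i=\deg y_i=\mathbf e_i\in\mathbb N^n$: fix any infinite extension field $L$ of $\mathbb K$ ($L=\mathbb K$ is allowed if $\mathbb K$ is infinite); then $\mathrm{gin}(J_G)\subset S$ is the ideal generated by the monomials that lie in $\mathrm{in}\big(g(J_G\cdot L[x_1,\dots,x_n,y_1,\dots,y_n])\big)$ for all $g$ in some nonempty Zariski-open subset of $\prod_{i=1}^n GL_2(L)$, where the $i$-th factor acts by linear changes of the two variables $x_i,y_i$. For an induced subgraph $H$ of $G$ with vertex set $V_H\subseteq[n]$, define $J_H$, $\mathrm{in}(J_H)$, $\mathrm{gin}(J_H)$ in the same way in $\mathbb K[x_j,y_j\mid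 j\in V_H]$, with the induced order of the variables and the same field $L$. For a squarefree monomial ideal $I$ in a polynomial ring in $N$ variables and $q\ge1$, let $I^{(q)}=\bigcap_P P^{(q)}$, where $P$ runs over the minimal primes of $I$ and $P^{(q)}=\{r\mid rs\in P^q\text{ for some } s\notin P\}$. Let $\mathrm{NP}(I^{(q)})\subset\mathbb R^N$ be the convex hull of the exponent vectors of the monomials in $I^{(q)}$, let $\mathrm{SP}(I)=\bigcup_{q\ge1}\frac1q\mathrm{NP}(I^{(q)})$ be the symbolic polyhedron, and let $\mathcal V(\mathrm{SP}(I))$ be its set of vertices (extreme points). A face of $\mathrm{SP}(I)$ is a set $\mathrm{SP}(I)\cap\{z\mid c\cdot z=b\}$, possibly empty, where $c\in\mathbb R^N$ and $b\in\mathbb R$ satisfy $c\cdot z\le b$ for all $z\in \mathrm{SP}(I)$. Let $H$ be an induced subgraph of $G$, and let $i:\mathbb R^{2|H|}\to\mathbb R^{2n}$ be the canonical inclusion, which keeps the coordinates belonging to $x_j,y_j$ for $j\in V_H$ and sets the coordinates belonging to $x_j,y_j$ for $j\notin V_H$ equal to $0$. Then, both for $I_G=\mathrm{in}(J_G)$,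 $I_H=\mathrm{in}(J_H)$ and for $I_G=\mathrm{gin}(J_G)$, $I_H=\mathrm{gin}(J_H)$, $$ i\big(\mathcal V(\mathrm{SP}(I_H))\big)\subseteq\mathcal V(\mathrm{SP}(I_G)). $$ Moreover, the set $F$ of all points of $\mathrm{SP}(I_G)$ whose coordinates belonging to $x_j,y_j$ vanish for all $j\in[n]\setminus V_H$ is a face of $\mathrm{SP}(I_G)$, and $i(\mathrm{SP}(I_H))=F$. -/

import Mathlib

/-! ### Binomial edge ideals, initial ideals and multigraded generic initial ideals -/

/-- The index set of the variables `x_v`, `y_v` with `v ∈ V`. It is ordered so that all `x`-indices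
precede all `y`-indices, and each group is ordered as `V`. -/
abbrev BEVar (V : Type*) : Type _ := V ⊕ₗ V

instance BEVar.instFinite (V : Type*) [Finite V] : Finite (BEVar V) :=
  inferInstanceAs (Finite (V ⊕ V))

/-- The index of the variable `x_v`. -/
abbrev xVar {V : Type*} (v : V) : BEVar V := Sum.inlₗ v

/-- The index of the variable `y_v`. -/
abbrev yVar {V : Type*} (v : V) : BEVar V := Sum.inrₗ v

/-- The binomial edge ideal `J_G = (x_i y_j - x_j y_i ∣ {i, j} ∈ E(G))` in `K[x_v, y_v ∣ v ∈ V]`. -/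
noncomputable def binomialEdgeIdeal (K : Type*) [Field K] {V : Type*} (G : SimpleGraph V) :
    Ideal (MvPolynomial (BEVar V) K) :=
  Ideal.span {f | ∃ i j : V, G.Adj i j ∧
    f = MvPolynomial.X (xVar i) * MvPolynomial.X (yVar j)
      - MvPolynomial.X (xVar j) * MvPolynomial.X (yVar i)}

/-- The initial ideal `in(I)`, generated by the leading monomials of the nonzero elements of `I`, for
the lexicographic order. In Mathlib's lexicographic order a variable with a smaller index is larger;
so `x_1 > ⋯ > x_n > y_1 > ⋯ > y_n` for `V = {1 < ⋯ < n}`. -/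
noncomputable def initialIdeal {K : Type*} [Field K] {V : Type*} [LinearOrder V] [Finite V]
    (I : Ideal (MvPolynomial (BEVar V) K)) : Ideal (MvPolynomial (BEVar V) K) :=
  Ideal.span {p | ∃ f ∈ I, f ≠ 0 ∧
    p = MvPolynomial.monomial ((MonomialOrder.lex (σ := BEVar V)).degree f) (1 : K)}

/-- The multigraded linear change of coordinates given by `g ∈ ∏_v GL_2(L)`: each of `x_v`, `y_v` is
sent to a linear combination of `x_v` and `y_v`, with coefficients the rows of `g_v`. -/
noncomputable def coordChange {L : Type*} [Field L] {V : Type*}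
    (g : V → Matrix.GeneralLinearGroup (Fin 2) L) :
    MvPolynomial (BEVar V) L →ₐ[L] MvPolynomial (BEVar V) L :=
  MvPolynomial.aeval fun k : BEVar V =>
    Sum.elim
      (fun v => MvPolynomial.C ((g v).val 0 0) * MvPolynomial.X (xVar v)
        + MvPolynomial.C ((g v).val 0 1) * MvPolynomial.X (yVar v))
      (fun v => MvPolynomial.C ((g v).val 1 0) * MvPolynomial.X (xVar v)
        + MvPolynomial.C ((g v).val 1 1) * MvPolynomial.X (yVar v))
      (ofLex k)

/-- `P` holds for general `g ∈ ∏_v GL_2(L)`: it holds on a nonempty Zariski-open subset, where `L` is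
an infinite field. (Over an infinite field every nonempty Zariski-open subset of `∏_v GL_2(L)`
contains the nonvanishing locus in `∏_v GL_2(L)` of a nonzero polynomial in the matrix entries, and
such a locus is nonempty and open.) -/
def HoldsForGeneral {L : Type*} [Field L] [Infinite L] {V : Type*}
    (P : (V → Matrix.GeneralLinearGroup (Fin 2) L) → Prop) : Prop :=
  ∃ f : MvPolynomial (V × Fin 2 × Fin 2) L, f ≠ 0 ∧
    ∀ g : V → Matrix.GeneralLinearGroup (Fin 2) L,
      MvPolynomial.eval (fun p => (g p.1).val p.2.1 p.2.2) f ≠ 0 → P g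

/-- The multigraded generic initial ideal `gin(I) ⊆ K[x_v, y_v]`: it is generated by the monomials
that belong to `in(g(I · L[x_v, y_v]))` for general `g ∈ ∏_v GL_2(L)`. Here `L` is an infinite
extension field of `K`, in which the general coefficients are taken; if `K` is infinite, one may take
`L = K`. For a multigraded ideal `I`, `in(g(I · L[x_v, y_v]))` takes one and the same value on a
nonempty Zariski-open set of `g`, and `gin(I)` is that value. -/
noncomputable def gin {K : Type*} [Field K] (L : Type*) [Field L] [Infinite L] [Algebra K L]
    {V : Type*} [LinearOrder V] [Finite V]
    (I : Ideal (MvPolynomial (BEVar V) K)) : Ideal (MvPolynomial (BEVar V) K) :=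
  Ideal.span {p | ∃ a : BEVar V →₀ ℕ, p = MvPolynomial.monomial a (1 : K) ∧
    HoldsForGeneral (L := L) (V := V) fun g =>
      MvPolynomial.monomial a (1 : L) ∈
        initialIdeal ((I.map (MvPolynomial.map (algebraMap K L))).map (coordChange g))}

/-! ### Symbolic powers and symbolic polyhedra -/

/-- The symbolic power `P^(m) = {r ∣ r q ∈ P^m for some q ∉ P}` of a prime ideal `P`. -/
def primeSymbolicPower {R : Type*} [CommRing R] (P : Ideal R) (hP : P.IsPrime) (m : ℕ) : Ideal R where
  carrier := {r | ∃ q, q ∉ P ∧ r * q ∈ P ^ m}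
  zero_mem' := ⟨1, P.ne_top_iff_one.1 hP.ne_top, by simp⟩
  add_mem' := by
    rintro a b ⟨q, hq, haq⟩ ⟨s, hs, hbs⟩
    refine ⟨q * s, fun h => (hP.mem_or_mem h).elim hq hs, ?_⟩
    have h1 : (a + b) * (q * s) = s * (a * q) + q * (b * s) := by ring
    rw [h1]
    exact Ideal.add_mem _ (Ideal.mul_mem_left _ _ haq) (Ideal.mul_mem_left _ _ hbs)
  smul_mem' := by
    rintro c a ⟨q, hq, haq⟩
    refine ⟨q, hq, ?_⟩
    rw [smul_eq_mul, mul_assoc]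
    exact Ideal.mul_mem_left _ _ haq

/-- The symbolic power `I^(m) = ⋂ P^(m)` of a radical ideal `I`, the intersection over the minimal
primes `P` of `I`. -/
def symbolicPower {R : Type*} [CommRing R] (I : Ideal R) (m : ℕ) : Ideal R :=
  ⨅ (P : Ideal R) (hP : P ∈ I.minimalPrimes), primeSymbolicPower P hP.1.1 m

/-- The Newton polyhedron of a monomial ideal: the convex hull of the exponent vectors of the
monomials in the ideal. -/
def newtonPolyhedron {K : Type*} [Field K] {σ : Type*} (I : Ideal (MvPolynomial σ K)) :
    Set (σ → ℝ) :=
  convexHull ℝ {z | ∃ a : σ →₀ ℕ, MvPolynomial.monomial a (1 : K) ∈ I ∧ z = fun i => (a i : ℝ)}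

/-- The symbolic polyhedron `SP(I) = ⋃_{q ≥ 1} (1/q) NP(I^(q))`. -/
def symbolicPolyhedron {K : Type*} [Field K] {σ : Type*} (I : Ideal (MvPolynomial σ K)) :
    Set (σ → ℝ) :=
  {z | ∃ q : ℕ, 1 ≤ q ∧ ∃ w ∈ newtonPolyhedron (symbolicPower I q), z = (q : ℝ)⁻¹ • w}

/-- `F` is a face of `P ⊆ ℝ^σ`: it is the intersection of `P` with the boundary `{c = b}` of a
halfspace `{c ≤ b}` that contains `P`. The empty face and `P` itself are allowed. -/
def IsFaceOf {σ : Type*} (F P : Set (σ → ℝ)) : Prop :=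
  ∃ (c : (σ → ℝ) →ₗ[ℝ] ℝ) (b : ℝ), (∀ z ∈ P, c z ≤ b) ∧ F = {z ∈ P | c z = b}

/-! ### Passing to an induced subgraph -/

open Classical in
/-- The canonical inclusion `ℝ^{2|W|} → ℝ^{2n}`: the coordinates of `x_v` and `y_v` are kept for
`v ∈ W` and are `0` for `v ∉ W`. -/
noncomputable def canonicalInclusion {V : Type*} (W : Set V) (a : BEVar W → ℝ) : BEVar V → ℝ :=
  fun k =>
    Sum.elim
      (fun v => if h : v ∈ W then a (xVar ⟨v, h⟩) else 0)
      (fun v => if h : v ∈ W then a (yVar ⟨v, h⟩) else 0)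
      (ofLex k)

/-- The points of `P` all of whose coordinates at `x_v` and `y_v` with `v ∉ W` vanish. -/
def vanishingOutside {V : Type*} (W : Set V) (P : Set (BEVar V → ℝ)) : Set (BEVar V → ℝ) :=
  {a ∈ P | ∀ v, v ∉ W → a (xVar v) = 0 ∧ a (yVar v) = 0}

/-! ### Monomial ideals and symbolic powers -/

/-! Setting all variables outside `W` to zero is a retraction of the polynomial ring onto the
subring in the variables of `W`. It maps `J_G` into `J_H`, because an edge with an endpoint outside
`W` has both terms of its binomial killed, and conversely `J_H` includes into `J_G`. A polynomial of
`J_G` whose leading monomial involves only variables of `W` keeps that leading monomial under the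
retraction, so the monomials of `in(J_H)` are exactly those of `in(J_G)` in the variables of `W`
(`monomial_mem_initialIdeal_restrict`). Coordinate changes that mix only `x_v` with `y_v` commute
with inclusion and retraction, so the same holds for `gin` (`monomial_mem_gin_restrict`).

The rest is about monomial ideals. The minimal primes are generated by variables, so `x^a ∈ I^(q)`
means that `a` has degree at least `q` on every cover of `I`. This criterion is compatible with
restriction to a subset of the variables (`monomial_mem_symbolicPower_restrict`). The Newton
polyhedra lie in the nonnegative orthant, so the points vanishing outside `W` are cut out by one
supporting hyperplane, and the part of a convex hull in such a hyperplane is the hull of the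
generators lying there. Scaling by `1/q` gives the coordinate face of the symbolic polyhedron
(`symbolicPolyhedron_restrict`), and vertices of a face are vertices of the whole. -/

/-- An ideal of a polynomial ring is monomial if it is generated by monomials. -/
def Ideal.IsMonomialIdeal {K : Type*} [Field K] {σ : Type*} (I : Ideal (MvPolynomial σ K)) : Prop :=
  ∃ S : Set (σ →₀ ℕ), I = Ideal.span ((fun a => MvPolynomial.monomial a (1 : K)) '' S)

/-- A set of variables covers `I` if every monomial of `I` is divisible by one of its members. -/
def Ideal.IsMonomialCover {K : Type*} [Field K] {σ : Type*} (I : Ideal (MvPolynomial σ K))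
    (A : Set σ) : Prop :=
  ∀ b : σ →₀ ℕ, MvPolynomial.monomial b (1 : K) ∈ I → ∃ i ∈ A, b i ≠ 0

section MonomialIdeals

open MvPolynomial

variable {K : Type*} [Field K] {σ : Type*}

theorem monomial_mem_span_monomial_iff {S : Set (σ →₀ ℕ)} {a : σ →₀ ℕ} :
    monomial a (1 : K) ∈ Ideal.span ((fun s => monomial s (1 : K)) '' S) ↔ ∃ s ∈ S, s ≤ a := by
  classical
  rw [mem_ideal_span_monomial_image]
  simp [support_monomial]

/-- It is the kernel of the map that kills the variables in `A`, whose target is the domain of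
polynomials in the other variables. -/
theorem isPrime_span_X_image (A : Set σ) :
    (Ideal.span ((X : σ → MvPolynomial σ K) '' A)).IsPrime := by
  have hinj : Function.Injective (Subtype.val : (Aᶜ : Set σ) → σ) := Subtype.val_injective
  have h : Ideal.span ((X : σ → MvPolynomial σ K) '' A)
      = RingHom.ker (killCompl (R := K) hinj).toRingHom := by
    ext f
    rw [mem_ideal_span_X_image, RingHom.mem_ker]
    constructor
    · intro hf
      ext s
      change coeff s (killCompl hinj f) = _
      rw [coeff_killCompl, coeff_zero]
      by_contra hne
      obtain ⟨i, hi, hi0⟩ := hf _ (mem_support_iff.2 hne)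
      exact hi0 (Finsupp.mapDomain_of_notMem_range _ _ (by simpa using hi))
    · intro hf m hm
      by_contra! hA
      have hr : (m.support : Set σ) ⊆ Set.range (Subtype.val : (Aᶜ : Set σ) → σ) := by
        intro i hi
        have : i ∉ A := fun hiA => (Finsupp.mem_support_iff.1 hi) (hA i hiA)
        simpa using this
      have h0 : coeff (m.comapDomain Subtype.val hinj.injOn) (killCompl hinj f) = 0 := by
        change killCompl hinj f = 0 at hf
        rw [hf, coeff_zero]
      rw [coeff_killCompl, Finsupp.mapDomain_comapDomain _ hinj _ hr] at h0
      exact mem_support_iff.1 hm h0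
  rw [h]
  exact RingHom.ker_isPrime _

theorem le_span_X_image_of_isMonomialCover {I : Ideal (MvPolynomial σ K)}
    (hI : I.IsMonomialIdeal) {A : Set σ} (hA : I.IsMonomialCover A) :
    I ≤ Ideal.span ((X : σ → MvPolynomial σ K) '' A) := by
  classical
  obtain ⟨S, rfl⟩ := hI
  rw [Ideal.span_le]
  rintro _ ⟨s, hs, rfl⟩
  rw [SetLike.mem_coe, mem_ideal_span_X_image]
  intro m hm
  obtain rfl : m = s := by simpa [support_monomial] using hm
  exact hA _ (Ideal.subset_span ⟨m, hs, rfl⟩)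

/-- A monomial is a product of powers of variables, so a prime containing it contains one of the
variables that occur. -/
theorem isMonomialCover_of_le_prime {I P : Ideal (MvPolynomial σ K)} (hP : P.IsPrime)
    (h : I ≤ P) : I.IsMonomialCover {i | (X i : MvPolynomial σ K) ∈ P} := by
  intro b hb
  have hbP := h hb
  rw [monomial_eq, C_1, one_mul, Finsupp.prod, hP.prod_mem_iff] at hbP
  obtain ⟨i, hi, hiP⟩ := hbP
  exact ⟨i, hP.mem_of_pow_mem _ hiP, Finsupp.mem_support_iff.1 hi⟩

theorem span_X_image_setOf_mem_le (P : Ideal (MvPolynomial σ K)) :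
    Ideal.span ((X : σ → MvPolynomial σ K) '' {i | (X i : MvPolynomial σ K) ∈ P}) ≤ P := by
  rw [Ideal.span_le]
  rintro _ ⟨i, hi, rfl⟩
  exact hi

theorem X_mem_span_X_image_iff {A : Set σ} {i : σ} :
    (X i : MvPolynomial σ K) ∈ Ideal.span ((X : σ → MvPolynomial σ K) '' A) ↔ i ∈ A := by
  classical
  rw [mem_ideal_span_X_image]
  simp [support_X, Finsupp.single_apply]

/-- A minimal prime of a monomial ideal is generated by the variables that it contains. -/
theorem eq_span_X_image_of_mem_minimalPrimes {I P : Ideal (MvPolynomial σ K)}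
    (hI : I.IsMonomialIdeal) (hP : P ∈ I.minimalPrimes) :
    P = Ideal.span ((X : σ → MvPolynomial σ K) '' {i | (X i : MvPolynomial σ K) ∈ P}) :=
  le_antisymm
    (hP.2 ⟨isPrime_span_X_image _, le_span_X_image_of_isMonomialCover hI
      (isMonomialCover_of_le_prime hP.1.1 hP.1.2)⟩ (span_X_image_setOf_mem_le P))
    (span_X_image_setOf_mem_le P)

open Classical in
theorem le_sum_of_mem_span_X_image_pow [Fintype σ] {A : Set σ} {q : ℕ} {f : MvPolynomial σ K}
    (hf : f ∈ Ideal.span ((X : σ → MvPolynomial σ K) '' A) ^ q) {m : σ →₀ ℕ}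
    (hm : m ∈ f.support) : q ≤ ∑ i with i ∈ A, m i := by
  have key : ∀ q : ℕ, Ideal.span ((X : σ → MvPolynomial σ K) '' A) ^ q ≤
      Ideal.span ((fun s => monomial s (1 : K)) '' {s | q ≤ ∑ i with i ∈ A, s i}) := by
    intro q
    induction q with
    | zero =>
      rw [pow_zero, Ideal.one_eq_top, top_le_iff, Ideal.eq_top_iff_one]
      exact Ideal.subset_span ⟨0, by simp, rfl⟩
    | succ q ih =>
      rw [pow_succ]
      refine (Ideal.mul_mono_left ih).trans ?_
      rw [Ideal.span_mul_span', Ideal.span_le]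
      rintro _ ⟨_, ⟨s, hs, rfl⟩, _, ⟨i, hi, rfl⟩, rfl⟩
      refine Ideal.subset_span ⟨s + Finsupp.single i 1, ?_, ?_⟩
      · have h1 : ∑ j with j ∈ A, (Finsupp.single i 1 : σ →₀ ℕ) j = 1 := by
          rw [Finset.sum_eq_single_of_mem i (by simpa using hi)]
          · simp
          · intro j _ hj
            simp [hj.symm]
        simp only [Set.mem_ofPred_eq, Finsupp.add_apply, Finset.sum_add_distrib, h1] at hs ⊢
        omega
      · simp [X, monomial_mul]
  obtain ⟨s, hs, hsm⟩ := mem_ideal_span_monomial_image.1 (key q hf) m hm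
  exact hs.trans (Finset.sum_le_sum fun i _ => hsm i)

open Classical in
/-- The monomials in the symbolic powers of a monomial ideal, in terms of its covers. -/
theorem monomial_mem_symbolicPower_iff [Fintype σ] {I : Ideal (MvPolynomial σ K)}
    (hI : I.IsMonomialIdeal) {q : ℕ} {a : σ →₀ ℕ} :
    monomial a (1 : K) ∈ symbolicPower I q ↔
      ∀ A : Set σ, I.IsMonomialCover A → q ≤ ∑ i with i ∈ A, a i := by
  constructor
  · intro ha A hA
    have hprime := isPrime_span_X_image (K := K) A
    -- The prime of a cover need not be minimal, so the argument uses a minimal prime below it; its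
    -- variables form a subset `B` of `A`.
    obtain ⟨P, hP, hPA⟩ := Ideal.exists_minimalPrimes_le (le_span_X_image_of_isMonomialCover hI hA)
    have ha' := ha
    simp only [symbolicPower, Submodule.mem_iInf] at ha'
    obtain ⟨s, hs, hsP⟩ := ha' P hP
    set B : Set σ := {i | (X i : MvPolynomial σ K) ∈ P} with hB
    have hPB : P = Ideal.span ((X : σ → MvPolynomial σ K) '' B) :=
      eq_span_X_image_of_mem_minimalPrimes hI hP
    have hBA : B ⊆ A := fun i hi => X_mem_span_X_image_iff.1 (hPA hi)
    -- Since `s ∉ P`, some term `x^c` of `s` avoids `B`. Then `x^(a+c)` occurs in an element of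
    -- `P^q` and has the same degree on `B` as `x^a`.
    rw [hPB, mem_ideal_span_X_image] at hs
    push Not at hs
    obtain ⟨c, hc, hcB⟩ := hs
    rw [hPB] at hsP
    have hm : a + c ∈ (monomial a (1 : K) * s).support := by
      rw [mem_support_iff, coeff_monomial_mul, one_mul]
      exact mem_support_iff.1 hc
    refine (le_sum_of_mem_span_X_image_pow hsP hm).trans ?_
    calc ∑ i with i ∈ B, (a + c) i = ∑ i with i ∈ B, a i :=
          Finset.sum_congr rfl fun i hi => by
            rw [Finsupp.add_apply, hcB i (Finset.mem_filter.1 hi).2, add_zero]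
      _ ≤ ∑ i with i ∈ A, a i :=
          Finset.sum_le_sum_of_subset fun i hi => by
            simp only [Finset.mem_filter, Finset.mem_univ, true_and] at hi ⊢
            exact hBA hi
  · intro h
    simp only [symbolicPower, Submodule.mem_iInf]
    intro P hP
    have hq := h _ (isMonomialCover_of_le_prime hP.1.1 hP.1.2)
    -- The multiplier can be `1`: the factor of `x^a` in the variables of `P` already lies in `P^q`.
    refine ⟨1, P.ne_top_iff_one.1 hP.1.1.ne_top, ?_⟩
    rw [mul_one, monomial_eq, C_1, one_mul, Finsupp.prod_fintype _ _ (fun i => pow_zero _),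
      ← Finset.prod_filter_mul_prod_filter_not Finset.univ
        (fun i => (X i : MvPolynomial σ K) ∈ P)]
    refine Ideal.mul_mem_right _ _ (Ideal.pow_le_pow_right hq ?_)
    rw [← Finset.prod_pow_eq_pow_sum]
    refine Ideal.prod_mem_prod fun i hi => Ideal.pow_mem_pow ?_ _
    simpa using hi

/-- If the monomials of `J` are those monomials of `I` that only involve the variables of a subset,
then the same holds for the symbolic powers. -/
theorem monomial_mem_symbolicPower_restrict [Finite σ] {τ : Type*} [Finite τ]
    {I : Ideal (MvPolynomial σ K)} {J : Ideal (MvPolynomial τ K)}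
    (hI : I.IsMonomialIdeal) (hJ : J.IsMonomialIdeal) (e : τ ↪ σ)
    (h : ∀ a : τ →₀ ℕ, monomial (a.mapDomain e) (1 : K) ∈ I ↔ monomial a (1 : K) ∈ J)
    {q : ℕ} {a : τ →₀ ℕ} :
    monomial (a.mapDomain e) (1 : K) ∈ symbolicPower I q ↔
      monomial a (1 : K) ∈ symbolicPower J q := by
  classical
  have := Fintype.ofFinite σ
  have := Fintype.ofFinite τ
  rw [monomial_mem_symbolicPower_iff hI, monomial_mem_symbolicPower_iff hJ]
  have hsum : ∀ A : Set σ, ∑ i with i ∈ A, a.mapDomain e i = ∑ j with j ∈ e ⁻¹' A, a j := by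
    intro A
    symm
    refine Finset.sum_of_injOn e e.injective.injOn ?_ ?_ ?_
    · intro j hj
      simpa using hj
    · intro i hi hni
      refine Finsupp.mapDomain_of_notMem_range _ _ ?_
      rintro ⟨j, rfl⟩
      exact hni ⟨j, by simpa using hi, rfl⟩
    · intro j _
      rw [Finsupp.mapDomain_apply e.injective]
  constructor
  · intro ha B hB
    -- Adding every variable outside the range turns a cover of `J` into one of `I`; the exponent
    -- vector vanishes there, so its degree on the cover is unchanged.
    have hcov : I.IsMonomialCover (e '' B ∪ (Set.range e)ᶜ) := by
      intro b hb
      by_cases hr : (b.support : Set σ) ⊆ Set.range e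
      · have hb' := Finsupp.mapDomain_comapDomain e e.injective b hr
        rw [← hb', h] at hb
        obtain ⟨j, hj, hj0⟩ := hB _ hb
        exact ⟨e j, Or.inl ⟨j, hj, rfl⟩, hj0⟩
      · obtain ⟨i, hi, hir⟩ := Set.not_subset.1 hr
        exact ⟨i, Or.inr hir, Finsupp.mem_support_iff.1 hi⟩
    have := ha _ hcov
    rw [hsum] at this
    have hpre : e ⁻¹' (e '' B ∪ (Set.range e)ᶜ) = B := by
      ext j
      simp
    rwa [hpre] at this
  · intro ha A hA
    rw [hsum]
    refine ha _ fun b hb => ?_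
    obtain ⟨i, hi, hi0⟩ := hA _ ((h b).2 hb)
    by_cases hr : i ∈ Set.range e
    · obtain ⟨j, rfl⟩ := hr
      exact ⟨j, hi, by rwa [Finsupp.mapDomain_apply e.injective] at hi0⟩
    · exact absurd (Finsupp.mapDomain_of_notMem_range _ _ hr) hi0

end MonomialIdeals

/-! ### Coordinate faces of symbolic polyhedra -/

/-- The points with the stated property form a convex set: a combination with positive weights of
nonnegative values is zero only if each value is zero. -/
theorem mem_convexHull_inter_of_nonneg {E : Type*} [AddCommGroup E] [Module ℝ E] {S : Set E}
    (c : E →ₗ[ℝ] ℝ) (hS : ∀ z ∈ S, 0 ≤ c z) {z : E} (hz : z ∈ convexHull ℝ S) :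
    0 ≤ c z ∧ (c z = 0 → z ∈ convexHull ℝ (S ∩ {z | c z = 0})) := by
  revert z
  change convexHull ℝ S ⊆ {z | 0 ≤ c z ∧ (c z = 0 → z ∈ convexHull ℝ (S ∩ {z | c z = 0}))}
  refine convexHull_min (fun z hz => ⟨hS z hz, fun h => subset_convexHull ℝ _ ⟨hz, h⟩⟩) ?_
  rw [convex_iff_forall_pos]
  rintro x ⟨hx, hx'⟩ y ⟨hy, hy'⟩ a b ha hb hab
  have e : c (a • x + b • y) = a * c x + b * c y := by simp
  have h1 : 0 ≤ a * c x := mul_nonneg ha.le hx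
  have h2 : 0 ≤ b * c y := mul_nonneg hb.le hy
  refine ⟨by rw [e]; exact add_nonneg h1 h2, fun h => ?_⟩
  rw [e] at h
  have h1' : a * c x = 0 := by linarith
  have h2' : b * c y = 0 := by linarith
  exact convex_convexHull ℝ _ (hx' ((mul_eq_zero.1 h1').resolve_left ha.ne'))
    (hy' ((mul_eq_zero.1 h2').resolve_left hb.ne')) ha.le hb.le hab

/-- If a linear functional attains its upper bound in the interior of a segment, it attains it at
both ends. -/
theorem IsFaceOf.isExtreme {σ : Type*} {F P : Set (σ → ℝ)} (h : IsFaceOf F P) :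
    IsExtreme ℝ P F := by
  obtain ⟨c, b, hc, rfl⟩ := h
  refine ⟨fun z hz => hz.1, ?_⟩
  rintro x hx y hy z ⟨-, hz⟩ ⟨s, t, hs, ht, hst, rfl⟩
  refine ⟨hx, le_antisymm (hc x hx) ?_⟩
  have e : s * c x + t * c y = b := by rw [← hz]; simp
  have h2 : t * c y ≤ t * b := mul_le_mul_of_nonneg_left (hc y hy) ht.le
  have h3 : s * b ≤ s * c x := by
    have : s * b + t * b = b := by rw [← add_mul, hst, one_mul]
    linarith
  exact le_of_mul_le_mul_left h3 hs

/-- The inclusion of the variables that belong to the vertices in `W`. -/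
def BEVar.incl {V : Type*} [LinearOrder V] (W : Set V) : BEVar W ↪o BEVar V :=
  OrderEmbedding.ofStrictMono
    (fun k => Sum.elim (fun v => xVar v.1) (fun v => yVar v.1) (ofLex k)) <| by
    intro a b hab
    induction a using Lex.rec with | _ a => ?_
    induction b using Lex.rec with | _ b => ?_
    rcases a with a | a <;> rcases b with b | b
    · have h : a < b := Sum.Lex.inl_lt_inl_iff.1 hab
      exact Sum.Lex.inl_lt_inl_iff.2 h
    · exact Sum.Lex.inl_lt_inr _ _
    · exact absurd hab Sum.Lex.not_inr_lt_inl
    · have h : a < b := Sum.Lex.inr_lt_inr_iff.1 hab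
      exact Sum.Lex.inr_lt_inr_iff.2 h

section Inclusion

variable {V : Type*} [LinearOrder V] {W : Set V}

@[simp]
theorem BEVar.incl_xVar (v : W) : BEVar.incl W (xVar v) = xVar v.1 := rfl

@[simp]
theorem BEVar.incl_yVar (v : W) : BEVar.incl W (yVar v) = yVar v.1 := rfl

theorem BEVar.forall_iff {V : Type*} {p : BEVar V → Prop} :
    (∀ k, p k) ↔ (∀ v, p (xVar v)) ∧ ∀ v, p (yVar v) :=
  ⟨fun h => ⟨fun _ => h _, fun _ => h _⟩, fun h k => by
    induction k using Lex.rec with | _ k => ?_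
    rcases k with v | v
    exacts [h.1 v, h.2 v]⟩

theorem BEVar.xVar_mem_range_incl {v : V} : xVar v ∈ Set.range (BEVar.incl W) ↔ v ∈ W := by
  constructor
  · rintro ⟨k, hk⟩
    revert k
    rw [BEVar.forall_iff]
    refine ⟨fun w hw => ?_, fun w hw => ?_⟩
    · obtain rfl : w.1 = v := by simpa using hw
      exact w.2
    · simp at hw
  · exact fun h => ⟨xVar ⟨v, h⟩, rfl⟩

theorem BEVar.yVar_mem_range_incl {v : V} : yVar v ∈ Set.range (BEVar.incl W) ↔ v ∈ W := by
  constructor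
  · rintro ⟨k, hk⟩
    revert k
    rw [BEVar.forall_iff]
    refine ⟨fun w hw => ?_, fun w hw => ?_⟩
    · simp at hw
    · obtain rfl : w.1 = v := by simpa using hw
      exact w.2
  · exact fun h => ⟨yVar ⟨v, h⟩, rfl⟩

theorem canonicalInclusion_incl (a : BEVar W → ℝ) (k : BEVar W) :
    canonicalInclusion W a (BEVar.incl W k) = a k := by
  revert k
  rw [BEVar.forall_iff]
  exact ⟨fun v => dif_pos v.2, fun v => dif_pos v.2⟩

theorem canonicalInclusion_of_notMem_range (a : BEVar W → ℝ) {k : BEVar V}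
    (hk : k ∉ Set.range (BEVar.incl W)) : canonicalInclusion W a k = 0 := by
  revert k
  rw [BEVar.forall_iff]
  exact ⟨fun v hv => dif_neg fun h => hv (BEVar.xVar_mem_range_incl.2 h),
    fun v hv => dif_neg fun h => hv (BEVar.yVar_mem_range_incl.2 h)⟩

theorem eq_canonicalInclusion {a : BEVar W → ℝ} {z : BEVar V → ℝ}
    (h : ∀ k, z (BEVar.incl W k) = a k) (h0 : ∀ k ∉ Set.range (BEVar.incl W), z k = 0) :
    z = canonicalInclusion W a := by
  ext k
  by_cases hk : k ∈ Set.range (BEVar.incl W)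
  · obtain ⟨k, rfl⟩ := hk
    rw [h, canonicalInclusion_incl]
  · rw [h0 k hk, canonicalInclusion_of_notMem_range _ hk]

/-- The canonical inclusion as a linear map. -/
noncomputable def canonicalInclusionLinear (W : Set V) : (BEVar W → ℝ) →ₗ[ℝ] (BEVar V → ℝ) where
  toFun := canonicalInclusion W
  map_add' a b := (eq_canonicalInclusion
    (fun k => by simp [canonicalInclusion_incl])
    (fun k hk => by simp [canonicalInclusion_of_notMem_range _ hk])).symm
  map_smul' r a := (eq_canonicalInclusion
    (fun k => by simp [canonicalInclusion_incl])
    (fun k hk => by simp [canonicalInclusion_of_notMem_range _ hk])).symm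

theorem canonicalInclusionLinear_apply (a : BEVar W → ℝ) :
    canonicalInclusionLinear W a = canonicalInclusion W a := rfl

theorem canonicalInclusion_injective : Function.Injective (canonicalInclusion W) := by
  intro a b h
  ext k
  rw [← canonicalInclusion_incl a, h, canonicalInclusion_incl]

theorem canonicalInclusion_natCast (a : BEVar W →₀ ℕ) :
    canonicalInclusion W (fun k => (a k : ℝ)) =
      fun k => ((a.mapDomain (BEVar.incl W) k : ℕ) : ℝ) :=
  (eq_canonicalInclusion
    (fun k => by rw [Finsupp.mapDomain_apply (BEVar.incl W).injective])
    (fun k hk => by rw [Finsupp.mapDomain_of_notMem_range _ _ hk, Nat.cast_zero])).symm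

theorem mem_vanishingOutside {P : Set (BEVar V → ℝ)} {z : BEVar V → ℝ} :
    z ∈ vanishingOutside W P ↔ z ∈ P ∧ ∀ k ∉ Set.range (BEVar.incl W), z k = 0 := by
  rw [BEVar.forall_iff]
  simp only [BEVar.xVar_mem_range_incl, BEVar.yVar_mem_range_incl, vanishingOutside,
    Set.mem_ofPred_eq, ← forall_and]

open Classical in
/-- The sum of the coordinates that do not belong to the vertices in `W`. -/
noncomputable def outsideSum [Fintype V] (W : Set V) : (BEVar V → ℝ) →ₗ[ℝ] ℝ :=
  letI : Fintype (BEVar V) := Fintype.ofFinite _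
  ∑ k with k ∉ Set.range (BEVar.incl W), LinearMap.proj k

theorem outsideSum_nonneg [Fintype V] {z : BEVar V → ℝ} (hz : 0 ≤ z) : 0 ≤ outsideSum W z := by
  rw [outsideSum, LinearMap.sum_apply]
  exact Finset.sum_nonneg fun k _ => hz k

/-- Nonnegativity lets a single linear functional detect the vanishing of all outside coordinates.
-/
theorem outsideSum_eq_zero_iff [Fintype V] {z : BEVar V → ℝ} (hz : 0 ≤ z) :
    outsideSum W z = 0 ↔ ∀ k ∉ Set.range (BEVar.incl W), z k = 0 := by
  simp only [outsideSum, LinearMap.sum_apply, LinearMap.proj_apply]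
  rw [Finset.sum_eq_zero_iff_of_nonneg fun k _ => hz k]
  simp

theorem newtonPolyhedron_nonneg {K : Type*} [Field K] {σ : Type*} {I : Ideal (MvPolynomial σ K)}
    {z : σ → ℝ} (hz : z ∈ newtonPolyhedron I) : 0 ≤ z := by
  refine convexHull_min (t := Set.Ici 0) ?_ (convex_Ici 0) hz
  rintro _ ⟨a, -, rfl⟩
  exact fun i => Nat.cast_nonneg _

theorem symbolicPolyhedron_nonneg {K : Type*} [Field K] {σ : Type*}
    {I : Ideal (MvPolynomial σ K)} {z : σ → ℝ} (hz : z ∈ symbolicPolyhedron I) : 0 ≤ z := by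
  obtain ⟨q, -, w, hw, rfl⟩ := hz
  exact smul_nonneg (by positivity) (newtonPolyhedron_nonneg hw)

/-- A linear image commutes with convex hulls, and the image of the generators for `J` is the set of
generators for `I` on the supporting hyperplane `outsideSum W = 0`. -/
theorem image_newtonPolyhedron [Fintype V] {K : Type*} [Field K]
    {I : Ideal (MvPolynomial (BEVar V) K)} {J : Ideal (MvPolynomial (BEVar W) K)}
    (h : ∀ a : BEVar W →₀ ℕ, MvPolynomial.monomial (a.mapDomain (BEVar.incl W)) (1 : K) ∈ I ↔
      MvPolynomial.monomial a (1 : K) ∈ J) :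
    canonicalInclusion W '' newtonPolyhedron J = vanishingOutside W (newtonPolyhedron I) := by
  have himage : canonicalInclusion W '' newtonPolyhedron J =
      convexHull ℝ (canonicalInclusion W '' {z | ∃ a : BEVar W →₀ ℕ,
        MvPolynomial.monomial a (1 : K) ∈ J ∧ z = fun i => (a i : ℝ)}) :=
    (canonicalInclusionLinear W).image_convexHull _
  have hgen : canonicalInclusion W '' {z | ∃ a : BEVar W →₀ ℕ,
        MvPolynomial.monomial a (1 : K) ∈ J ∧ z = fun i => (a i : ℝ)} =
      {z | ∃ a : BEVar V →₀ ℕ,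
        MvPolynomial.monomial a (1 : K) ∈ I ∧ z = fun i => (a i : ℝ)} ∩
          {z | outsideSum W z = 0} := by
    ext z
    constructor
    · rintro ⟨_, ⟨a, ha, rfl⟩, rfl⟩
      have hn : 0 ≤ canonicalInclusion W (fun k => (a k : ℝ)) := by
        rw [canonicalInclusion_natCast]
        exact fun k => Nat.cast_nonneg _
      exact ⟨⟨_, (h a).2 ha, canonicalInclusion_natCast a⟩,
        (outsideSum_eq_zero_iff hn).2 fun k hk => canonicalInclusion_of_notMem_range _ hk⟩
    · rintro ⟨⟨b, hb, rfl⟩, hz⟩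
      have hz' := (outsideSum_eq_zero_iff (fun k => Nat.cast_nonneg _)).1 hz
      have hr : (b.support : Set (BEVar V)) ⊆ Set.range (BEVar.incl W) := by
        intro k hk
        by_contra hn
        exact Finsupp.mem_support_iff.1 hk (by exact_mod_cast hz' k hn)
      have hb' := Finsupp.mapDomain_comapDomain _ (BEVar.incl W).injective b hr
      refine ⟨_, ⟨_, (h _).1 (hb'.symm ▸ hb), rfl⟩, ?_⟩
      rw [canonicalInclusion_natCast, hb']
  rw [himage, hgen]
  ext z
  rw [mem_vanishingOutside]
  constructor
  · intro hz
    have hzI : z ∈ newtonPolyhedron I := convexHull_mono Set.inter_subset_left hz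
    refine ⟨hzI, (outsideSum_eq_zero_iff (newtonPolyhedron_nonneg hzI)).1 ?_⟩
    exact convexHull_min (t := {z | outsideSum W z = 0}) Set.inter_subset_right
      (convex_hyperplane (outsideSum W).isLinear 0) hz
  · rintro ⟨hz, hz0⟩
    refine (mem_convexHull_inter_of_nonneg (outsideSum W) ?_ hz).2
      ((outsideSum_eq_zero_iff (newtonPolyhedron_nonneg hz)).2 hz0)
    rintro _ ⟨a, -, rfl⟩
    exact outsideSum_nonneg fun k => Nat.cast_nonneg _

theorem isFaceOf_vanishingOutside [Fintype V] {P : Set (BEVar V → ℝ)} (hP : ∀ z ∈ P, 0 ≤ z) :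
    IsFaceOf (vanishingOutside W P) P := by
  refine ⟨-outsideSum W, 0, fun z hz => ?_, ?_⟩
  · simpa using outsideSum_nonneg (hP z hz)
  · ext z
    rw [mem_vanishingOutside]
    refine and_congr_right fun hz => ?_
    rw [LinearMap.neg_apply, neg_eq_zero, outsideSum_eq_zero_iff (hP z hz)]

/-- The symbolic polyhedron of the restriction of a monomial ideal to the variables of `W` is a
coordinate face, and its vertices are vertices of the whole polyhedron. -/
theorem symbolicPolyhedron_restrict [Fintype V] {K : Type*} [Field K]
    {I : Ideal (MvPolynomial (BEVar V) K)} {J : Ideal (MvPolynomial (BEVar W) K)}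
    (hI : I.IsMonomialIdeal) (hJ : J.IsMonomialIdeal)
    (h : ∀ a : BEVar W →₀ ℕ, MvPolynomial.monomial (a.mapDomain (BEVar.incl W)) (1 : K) ∈ I ↔
      MvPolynomial.monomial a (1 : K) ∈ J) :
    canonicalInclusion W '' (symbolicPolyhedron J).extremePoints ℝ ⊆
        (symbolicPolyhedron I).extremePoints ℝ ∧
      canonicalInclusion W '' symbolicPolyhedron J = vanishingOutside W (symbolicPolyhedron I) ∧
      IsFaceOf (vanishingOutside W (symbolicPolyhedron I)) (symbolicPolyhedron I) := by
  have hface : IsFaceOf (vanishingOutside W (symbolicPolyhedron I)) (symbolicPolyhedron I) :=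
    isFaceOf_vanishingOutside fun z hz => symbolicPolyhedron_nonneg hz
  have hnewton : ∀ q : ℕ, canonicalInclusion W '' newtonPolyhedron (symbolicPower J q) =
      vanishingOutside W (newtonPolyhedron (symbolicPower I q)) := fun q =>
    image_newtonPolyhedron fun a =>
      monomial_mem_symbolicPower_restrict hI hJ (BEVar.incl W).toEmbedding h
  have himage : canonicalInclusion W '' symbolicPolyhedron J =
      vanishingOutside W (symbolicPolyhedron I) := by
    ext z
    rw [mem_vanishingOutside]
    constructor
    · rintro ⟨_, ⟨q, hq, w, hw, rfl⟩, rfl⟩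
      refine ⟨⟨q, hq, canonicalInclusion W w, ?_, (canonicalInclusionLinear W).map_smul _ _⟩,
        fun k hk => canonicalInclusion_of_notMem_range _ hk⟩
      have : canonicalInclusion W w ∈ vanishingOutside W (newtonPolyhedron (symbolicPower I q)) :=
        hnewton q ▸ Set.mem_image_of_mem _ hw
      exact this.1
    · rintro ⟨⟨q, hq, w, hw, rfl⟩, h0⟩
      have hq0 : (q : ℝ)⁻¹ ≠ 0 := inv_ne_zero (by positivity)
      have hw' : w ∈ vanishingOutside W (newtonPolyhedron (symbolicPower I q)) :=
        mem_vanishingOutside.2 ⟨hw, fun k hk =>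
          (mul_eq_zero.1 (h0 k hk)).resolve_left hq0⟩
      rw [← hnewton] at hw'
      obtain ⟨u, hu, rfl⟩ := hw'
      exact ⟨(q : ℝ)⁻¹ • u, ⟨q, hq, u, hu, rfl⟩, (canonicalInclusionLinear W).map_smul _ _⟩
  refine ⟨?_, himage, hface⟩
  -- Extreme points of an extreme subset are extreme in the whole set; it remains to transport them
  -- along the injective linear inclusion.
  have hext := hface.isExtreme.extremePoints_subset_extremePoints
  rw [← himage] at hext
  refine subset_trans ?_ hext
  rintro _ ⟨z, hz, rfl⟩
  refine ⟨Set.mem_image_of_mem _ hz.1, ?_⟩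
  rintro _ ⟨x, hx, rfl⟩ _ ⟨y, hy, rfl⟩ ⟨s, t, hs, ht, hst, hxy⟩
  refine congrArg _ (hz.2 hx hy ⟨s, t, hs, ht, hst, canonicalInclusion_injective ?_⟩)
  rw [← hxy]
  simp only [← canonicalInclusionLinear_apply, map_add, map_smul]

end Inclusion

/-! ### Initial ideals of restrictions -/

section InitialIdeals

open MvPolynomial MonomialOrder

/-- The first difference moves from `j` to `e j`: an earlier index is either the image of one before
`j` or outside the range, where both exponents vanish. -/
theorem toLex_mapDomain_strictMono {σ τ : Type*} [LinearOrder σ] [LinearOrder τ] (e : τ ↪o σ) :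
    StrictMono fun a : Lex (τ →₀ ℕ) => toLex ((ofLex a).mapDomain e) := by
  intro a b hab
  obtain ⟨j, hj, hlt⟩ := Finsupp.Lex.lt_iff.1 hab
  refine Finsupp.Lex.lt_iff.2 ⟨e j, fun i hi => ?_, ?_⟩
  · by_cases hr : i ∈ Set.range e
    · obtain ⟨k, rfl⟩ := hr
      simp only [ofLex_toLex, Finsupp.mapDomain_apply e.injective]
      exact hj k (e.lt_iff_lt.1 hi)
    · simp only [ofLex_toLex, Finsupp.mapDomain_of_notMem_range _ _ hr]
  · simpa only [ofLex_toLex, Finsupp.mapDomain_apply e.injective] using hlt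

theorem lex_mapDomain_le_iff {σ τ : Type*} [LinearOrder σ] [LinearOrder τ] [WellFoundedGT σ]
    [WellFoundedGT τ] (e : τ ↪o σ) {a b : τ →₀ ℕ} :
    (lex (σ := σ)).toSyn (a.mapDomain e) ≤ (lex (σ := σ)).toSyn (b.mapDomain e) ↔
      (lex (σ := τ)).toSyn a ≤ (lex (σ := τ)).toSyn b :=
  (toLex_mapDomain_strictMono e).le_iff_le (a := toLex a) (b := toLex b)

theorem MonomialOrder.degree_eq_of_forall_le {σ R : Type*} [CommSemiring R] (m : MonomialOrder σ)
    {f : MvPolynomial σ R} {d : σ →₀ ℕ} (hd : d ∈ f.support)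
    (h : ∀ c ∈ f.support, m.toSyn c ≤ m.toSyn d) : m.degree f = d :=
  m.toSyn.injective (le_antisymm (m.degree_le_iff.2 h) (m.le_degree hd))

theorem isMonomialIdeal_initialIdeal {K : Type*} [Field K] {V : Type*} [LinearOrder V] [Finite V]
    (I : Ideal (MvPolynomial (BEVar V) K)) : (initialIdeal I).IsMonomialIdeal := by
  refine ⟨{a | ∃ f ∈ I, f ≠ 0 ∧ a = (lex (σ := BEVar V)).degree f}, congrArg Ideal.span ?_⟩
  ext p
  constructor
  · rintro ⟨f, hf, hf0, rfl⟩
    exact ⟨_, ⟨f, hf, hf0, rfl⟩, rfl⟩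
  · rintro ⟨_, ⟨f, hf, hf0, rfl⟩, rfl⟩
    exact ⟨f, hf, hf0, rfl⟩

theorem monomial_mem_initialIdeal_iff {K : Type*} [Field K] {V : Type*} [LinearOrder V] [Finite V]
    {I : Ideal (MvPolynomial (BEVar V) K)} {a : BEVar V →₀ ℕ} :
    monomial a (1 : K) ∈ initialIdeal I ↔
      ∃ f ∈ I, f ≠ 0 ∧ (lex (σ := BEVar V)).degree f ≤ a := by
  classical
  constructor
  · intro h
    obtain ⟨S, hS⟩ : ∃ S : Set (BEVar V →₀ ℕ),
        S = {a | ∃ f ∈ I, f ≠ 0 ∧ a = (lex (σ := BEVar V)).degree f} := ⟨_, rfl⟩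
    have hI : initialIdeal I ≤ Ideal.span ((fun s => monomial s (1 : K)) '' S) := by
      refine Ideal.span_mono ?_
      rintro _ ⟨f, hf, hf0, rfl⟩
      exact ⟨_, hS ▸ ⟨f, hf, hf0, rfl⟩, rfl⟩
    obtain ⟨s, hs, hsa⟩ := monomial_mem_span_monomial_iff.1 (hI h)
    rw [hS] at hs
    obtain ⟨f, hf, hf0, rfl⟩ := hs
    exact ⟨f, hf, hf0, hsa⟩
  · rintro ⟨f, hf, hf0, hle⟩
    have : monomial a (1 : K) = monomial (a - (lex (σ := BEVar V)).degree f) 1 *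
        monomial ((lex (σ := BEVar V)).degree f) 1 := by
      rw [monomial_mul, tsub_add_cancel_of_le hle, one_mul]
    rw [this]
    exact Ideal.mul_mem_left _ _ (Ideal.subset_span ⟨f, hf, hf0, rfl⟩)

/-- If `J` is both contained in `I` and the image of `I` under setting the variables outside `W`
to zero, then the monomials of `in(J)` are those of `in(I)` in the variables of `W`. -/
theorem monomial_mem_initialIdeal_restrict {K : Type*} [Field K] {V : Type*} [LinearOrder V]
    [Finite V] {W : Set V} {I : Ideal (MvPolynomial (BEVar V) K)}
    {J : Ideal (MvPolynomial (BEVar W) K)}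
    (hJI : ∀ f ∈ J, rename (BEVar.incl W) f ∈ I)
    (hIJ : ∀ f ∈ I, killCompl (BEVar.incl W).injective f ∈ J) (a : BEVar W →₀ ℕ) :
    monomial (a.mapDomain (BEVar.incl W)) (1 : K) ∈ initialIdeal I ↔
      monomial a (1 : K) ∈ initialIdeal J := by
  have hinj := (BEVar.incl W).injective
  rw [monomial_mem_initialIdeal_iff, monomial_mem_initialIdeal_iff]
  constructor
  · rintro ⟨f, hf, hf0, hle⟩
    -- The leading monomial divides one in the variables of `W`, so it survives the retraction. The
    -- retraction only deletes terms, so it remains leading.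
    have hsub : (((lex (σ := BEVar V)).degree f).support : Set (BEVar V)) ⊆
        Set.range (BEVar.incl W) := by
      intro k hk
      by_contra hn
      have hk0 := hle k
      rw [Finsupp.mapDomain_of_notMem_range _ _ hn] at hk0
      exact Finsupp.mem_support_iff.1 hk (Nat.le_zero.1 hk0)
    obtain ⟨d, hd⟩ : ∃ d : BEVar W →₀ ℕ,
        d.mapDomain (BEVar.incl W) = (lex (σ := BEVar V)).degree f :=
      ⟨_, Finsupp.mapDomain_comapDomain _ hinj _ hsub⟩
    have hdf : d ∈ (killCompl hinj f).support := by
      rw [mem_support_iff, coeff_killCompl, hd, ← mem_support_iff]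
      exact degree_mem_support hf0
    have hdeg : (lex (σ := BEVar W)).degree (killCompl hinj f) = d := by
      refine degree_eq_of_forall_le _ hdf fun c hc => ?_
      rw [← lex_mapDomain_le_iff (BEVar.incl W), hd]
      rw [mem_support_iff, coeff_killCompl, ← mem_support_iff] at hc
      exact le_degree hc
    refine ⟨_, hIJ f hf, fun h0 => by simp [h0] at hdf, ?_⟩
    rw [hdeg]
    intro k
    have hk := hle (BEVar.incl W k)
    rwa [← hd, Finsupp.mapDomain_apply hinj, Finsupp.mapDomain_apply hinj] at hk
  · rintro ⟨f, hf, hf0, hle⟩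
    have hdeg : (lex (σ := BEVar V)).degree (rename (BEVar.incl W) f) =
        ((lex (σ := BEVar W)).degree f).mapDomain (BEVar.incl W) := by
      refine degree_eq_of_forall_le _ ?_ fun c hc => ?_
      · rw [mem_support_iff, coeff_rename_mapDomain _ hinj, ← mem_support_iff]
        exact degree_mem_support hf0
      · obtain ⟨u, rfl, hu⟩ := coeff_rename_ne_zero _ _ _ (mem_support_iff.1 hc)
        rw [lex_mapDomain_le_iff]
        exact le_degree (mem_support_iff.2 hu)
    refine ⟨_, hJI f hf, fun h0 => hf0 (rename_injective _ hinj (by rw [h0, map_zero])), ?_⟩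
    rw [hdeg]
    exact Finsupp.mapDomain_mono hle

end InitialIdeals

/-! ### Binomial edge ideals of induced subgraphs -/

section Induce

open MvPolynomial

theorem killCompl_X_incl {K : Type*} [CommRing K] {V : Type*} [LinearOrder V] {W : Set V}
    (k : BEVar W) :
    killCompl (BEVar.incl W).injective (X (BEVar.incl W k) : MvPolynomial (BEVar V) K) = X k := by
  rw [← rename_X, killCompl_rename_app]

theorem killCompl_X_of_notMem {K : Type*} [CommRing K] {V : Type*} [LinearOrder V] {W : Set V}
    {k : BEVar V} (hk : k ∉ Set.range (BEVar.incl W)) :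
    killCompl (BEVar.incl W).injective (X k : MvPolynomial (BEVar V) K) = 0 := by
  rw [killCompl, aeval_X, dif_neg hk]

variable {V : Type*} [LinearOrder V] {W : Set V}

theorem rename_mem_binomialEdgeIdeal (K : Type*) [Field K] (G : SimpleGraph V)
    {f : MvPolynomial (BEVar W) K} (hf : f ∈ binomialEdgeIdeal K (G.induce W)) :
    rename (BEVar.incl W) f ∈ binomialEdgeIdeal K G := by
  suffices h : binomialEdgeIdeal K (G.induce W) ≤
      (binomialEdgeIdeal K G).comap (rename (BEVar.incl W)) from h hf
  refine Ideal.span_le.2 ?_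
  rintro _ ⟨i, j, hij, rfl⟩
  refine Ideal.subset_span ⟨i.1, j.1, hij, ?_⟩
  simp only [map_sub, map_mul, rename_X, BEVar.incl_xVar, BEVar.incl_yVar]

theorem killCompl_mem_binomialEdgeIdeal (K : Type*) [Field K] (G : SimpleGraph V)
    {f : MvPolynomial (BEVar V) K} (hf : f ∈ binomialEdgeIdeal K G) :
    killCompl (BEVar.incl W).injective f ∈ binomialEdgeIdeal K (G.induce W) := by
  suffices h : binomialEdgeIdeal K G ≤
      (binomialEdgeIdeal K (G.induce W)).comap (killCompl (BEVar.incl W).injective) from h hf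
  refine Ideal.span_le.2 ?_
  rintro _ ⟨i, j, hij, rfl⟩
  rw [SetLike.mem_coe, Ideal.mem_comap, map_sub, map_mul, map_mul]
  by_cases hi : i ∈ W
  · by_cases hj : j ∈ W
    · refine Ideal.subset_span ⟨⟨i, hi⟩, ⟨j, hj⟩, hij, ?_⟩
      simp only [← killCompl_X_incl (K := K), BEVar.incl_xVar, BEVar.incl_yVar]
    · rw [killCompl_X_of_notMem (k := xVar j) (by rwa [BEVar.xVar_mem_range_incl]),
        killCompl_X_of_notMem (k := yVar j) (by rwa [BEVar.yVar_mem_range_incl])]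
      simp
  · rw [killCompl_X_of_notMem (k := xVar i) (by rwa [BEVar.xVar_mem_range_incl]),
      killCompl_X_of_notMem (k := yVar i) (by rwa [BEVar.yVar_mem_range_incl])]
    simp

/-- Serves to carry the two inclusions between the ideals through extension of scalars and through
the coordinate change. -/
theorem mem_map_of_commute {R R' S S' : Type*} [CommRing R] [CommRing R'] [CommRing S]
    [CommRing S'] (α : R →+* S) (β : R' →+* S') (ψ' : R →+* R') (ψ : S →+* S')
    (hcomm : ∀ x, β (ψ' x) = ψ (α x)) {J : Ideal R} {I : Ideal S} (h : ∀ f ∈ J, α f ∈ I)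
    {f : R'} (hf : f ∈ J.map ψ') : β f ∈ I.map ψ := by
  have hle : J.map ψ' ≤ (I.map ψ).comap β := Ideal.map_le_iff_le_comap.2 fun x hx => by
    rw [Ideal.mem_comap, Ideal.mem_comap, hcomm]
    exact Ideal.mem_map_of_mem ψ (h x hx)
  exact Ideal.mem_comap.1 (hle hf)

theorem rename_coordChange {L : Type*} [Field L] (g : V → Matrix.GeneralLinearGroup (Fin 2) L)
    (f : MvPolynomial (BEVar W) L) :
    rename (BEVar.incl W) (coordChange (fun v : W => g v) f) =
      coordChange g (rename (BEVar.incl W) f) := by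
  suffices h : (rename (BEVar.incl W)).comp (coordChange fun v : W => g v) =
      (coordChange g).comp (rename (BEVar.incl W)) from DFunLike.congr_fun h f
  refine algHom_ext ?_
  rw [BEVar.forall_iff]
  simp [coordChange]

/-- This is where the multigrading enters: `g` mixes only `x_v` with `y_v`, so it preserves the span
of the variables outside `W`. -/
theorem killCompl_coordChange {L : Type*} [Field L]
    (g : V → Matrix.GeneralLinearGroup (Fin 2) L) (f : MvPolynomial (BEVar V) L) :
    killCompl (BEVar.incl W).injective (coordChange g f) =
      coordChange (fun v : W => g v) (killCompl (BEVar.incl W).injective f) := by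
  suffices h : (killCompl (BEVar.incl W).injective).comp (coordChange g) =
      (coordChange fun v : W => g v).comp (killCompl (BEVar.incl W).injective) from
    DFunLike.congr_fun h f
  have hx : ∀ v : W, killCompl (BEVar.incl W).injective
      (X (xVar v.1) : MvPolynomial (BEVar V) L) = X (xVar v) := fun v => killCompl_X_incl (xVar v)
  have hy : ∀ v : W, killCompl (BEVar.incl W).injective
      (X (yVar v.1) : MvPolynomial (BEVar V) L) = X (yVar v) := fun v => killCompl_X_incl (yVar v)
  have hx0 : ∀ v ∉ W, killCompl (BEVar.incl W).injective
      (X (xVar v) : MvPolynomial (BEVar V) L) = 0 := fun v hv =>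
    killCompl_X_of_notMem (by rwa [BEVar.xVar_mem_range_incl])
  have hy0 : ∀ v ∉ W, killCompl (BEVar.incl W).injective
      (X (yVar v) : MvPolynomial (BEVar V) L) = 0 := fun v hv =>
    killCompl_X_of_notMem (by rwa [BEVar.yVar_mem_range_incl])
  refine algHom_ext ?_
  rw [BEVar.forall_iff]
  constructor <;> intro v <;> by_cases hv : v ∈ W
  · have h1 := hx ⟨v, hv⟩
    have h2 := hy ⟨v, hv⟩
    simp [coordChange, h1, h2]
  · simp [coordChange, hx0 v hv, hy0 v hv]
  · have h1 := hx ⟨v, hv⟩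
    have h2 := hy ⟨v, hv⟩
    simp [coordChange, h1, h2]
  · simp [coordChange, hx0 v hv, hy0 v hv]

end Induce

/-! ### Multigraded generic initial ideals of restrictions -/

section Gin

open MvPolynomial

variable {L : Type*} [Field L] [Infinite L] {V : Type*}

/-- A nonzero polynomial in the matrix entries does not vanish at some invertible matrices. -/
theorem exists_eval_generalLinearGroup_ne_zero [Finite V] {f : MvPolynomial (V × Fin 2 × Fin 2) L}
    (hf : f ≠ 0) : ∃ g : V → Matrix.GeneralLinearGroup (Fin 2) L,
      eval (fun p => (g p.1).val p.2.1 p.2.2) f ≠ 0 := by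
  have := Fintype.ofFinite V
  have hdet : ∀ v : V, (X (v, 0, 0) * X (v, 1, 1) - X (v, 0, 1) * X (v, 1, 0) :
      MvPolynomial (V × Fin 2 × Fin 2) L) ≠ 0 := by
    intro v h
    have := congrArg (eval fun p : V × Fin 2 × Fin 2 => if p.2.1 = p.2.2 then (1 : L) else 0) h
    simp at this
  -- Multiplying by all determinants makes a nonvanishing point a tuple of invertible matrices.
  have hprod := mul_ne_zero hf (Finset.prod_ne_zero_iff.2 fun v (_ : v ∈ Finset.univ) => hdet v)
  obtain ⟨x, hx⟩ : ∃ x, eval x (f * ∏ v : V, (X (v, 0, 0) * X (v, 1, 1) - X (v, 0, 1) *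
      X (v, 1, 0))) ≠ 0 := by
    by_contra! h
    exact hprod (funext fun x => by rw [h, map_zero])
  rw [map_mul, map_prod] at hx
  have hx2 := Finset.prod_ne_zero_iff.1 (right_ne_zero_of_mul hx)
  refine ⟨fun v => Matrix.GeneralLinearGroup.mkOfDetNeZero
    (Matrix.of fun i j => x (v, i, j)) ?_, left_ne_zero_of_mul hx⟩
  have := hx2 v (Finset.mem_univ v)
  rw [Matrix.det_fin_two]
  simpa using this

/-- A property of the matrices belonging to `W` holds for general matrices on `V` if and only if it
holds for general matrices on `W`. -/
theorem holdsForGeneral_restrict_iff [Finite V] {W : Set V}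
    {P : (W → Matrix.GeneralLinearGroup (Fin 2) L) → Prop} :
    (HoldsForGeneral fun g : V → Matrix.GeneralLinearGroup (Fin 2) L => P fun v => g v) ↔
      HoldsForGeneral P := by
  classical
  constructor
  · rintro ⟨f, hf, hP⟩
    obtain ⟨g₀, hg₀⟩ := exists_eval_generalLinearGroup_ne_zero hf
    -- The entries outside `W` are specialized to those of `g₀`. The result is nonzero, since at the
    -- restriction of `g₀` it takes the value `f(g₀) ≠ 0`.
    let f' : MvPolynomial (W × Fin 2 × Fin 2) L := aeval (fun p : V × Fin 2 × Fin 2 =>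
      if h : p.1 ∈ W then X (⟨p.1, h⟩, p.2) else C ((g₀ p.1).val p.2.1 p.2.2)) f
    have heval : ∀ g : W → Matrix.GeneralLinearGroup (Fin 2) L,
        eval (fun p => (g p.1).val p.2.1 p.2.2) f' =
          eval (fun p => ((if h : p.1 ∈ W then g ⟨p.1, h⟩ else g₀ p.1 :
            Matrix.GeneralLinearGroup (Fin 2) L)).val p.2.1 p.2.2) f := by
      intro g
      rw [← coe_aeval_eq_eval, ← coe_aeval_eq_eval]
      simp only [f', RingHom.coe_coe]
      rw [← AlgHom.comp_apply]
      congr 1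
      refine algHom_ext fun p => ?_
      by_cases h : p.1 ∈ W <;> simp [h]
    refine ⟨f', fun h0 => ?_, fun g hg => ?_⟩
    · have h1 := heval fun v => g₀ v
      rw [h0, map_zero] at h1
      exact hg₀ (by simpa using h1.symm)
    · rw [heval] at hg
      have := hP (fun v => if h : v ∈ W then g ⟨v, h⟩ else g₀ v) hg
      simpa using this
  · rintro ⟨f, hf, hP⟩
    have hinj : Function.Injective (Prod.map Subtype.val id : W × Fin 2 × Fin 2 → V × Fin 2 × Fin 2) :=
      Subtype.val_injective.prodMap Function.injective_id
    refine ⟨rename (Prod.map Subtype.val id) f,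
      fun h0 => hf (rename_injective _ hinj (by rw [h0, map_zero])), fun g hg => hP _ ?_⟩
    rw [eval_rename] at hg
    exact hg

variable {K : Type*} [Field K] [Algebra K L] [LinearOrder V] [Finite V]

theorem isMonomialIdeal_gin (I : Ideal (MvPolynomial (BEVar V) K)) :
    (gin L I).IsMonomialIdeal := by
  refine ⟨{a | HoldsForGeneral (L := L) (V := V) fun g => monomial a (1 : L) ∈
    initialIdeal ((I.map (MvPolynomial.map (algebraMap K L))).map (coordChange g))},
    congrArg Ideal.span ?_⟩
  ext p
  constructor
  · rintro ⟨a, rfl, ha⟩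
    exact ⟨a, ha, rfl⟩
  · rintro ⟨a, ha, rfl⟩
    exact ⟨a, rfl, ha⟩

/-- The generating set is closed under multiples: a monomial divisible by a generator lies in the
initial ideal on that generator's own open set. So the span adds no monomials. -/
theorem monomial_mem_gin_iff {I : Ideal (MvPolynomial (BEVar V) K)} {a : BEVar V →₀ ℕ} :
    monomial a (1 : K) ∈ gin L I ↔
      HoldsForGeneral (L := L) (V := V) fun g => monomial a (1 : L) ∈
        initialIdeal ((I.map (MvPolynomial.map (algebraMap K L))).map (coordChange g)) := by
  constructor
  · intro h
    obtain ⟨S, hS⟩ : ∃ S : Set (BEVar V →₀ ℕ), S = {a | HoldsForGeneral (L := L) (V := V) fun g =>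
        monomial a (1 : L) ∈
          initialIdeal ((I.map (MvPolynomial.map (algebraMap K L))).map (coordChange g))} :=
      ⟨_, rfl⟩
    have hI : gin L I ≤ Ideal.span ((fun s => monomial s (1 : K)) '' S) := by
      refine Ideal.span_mono ?_
      rintro _ ⟨b, rfl, hb⟩
      exact ⟨b, hS ▸ hb, rfl⟩
    obtain ⟨s, hs, hsa⟩ := monomial_mem_span_monomial_iff.1 (hI h)
    rw [hS] at hs
    obtain ⟨f, hf, hP⟩ := hs
    refine ⟨f, hf, fun g hg => ?_⟩
    obtain ⟨p, hp, hp0, hle⟩ := monomial_mem_initialIdeal_iff.1 (hP g hg)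
    exact monomial_mem_initialIdeal_iff.2 ⟨p, hp, hp0, hle.trans hsa⟩
  · exact fun h => Ideal.subset_span ⟨a, rfl, h⟩

theorem monomial_mem_gin_restrict {W : Set V} {I : Ideal (MvPolynomial (BEVar V) K)}
    {J : Ideal (MvPolynomial (BEVar W) K)}
    (hJI : ∀ f ∈ J, rename (BEVar.incl W) f ∈ I)
    (hIJ : ∀ f ∈ I, killCompl (BEVar.incl W).injective f ∈ J) (a : BEVar W →₀ ℕ) :
    monomial (a.mapDomain (BEVar.incl W)) (1 : K) ∈ gin L I ↔ monomial a (1 : K) ∈ gin L J := by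
  rw [monomial_mem_gin_iff, monomial_mem_gin_iff, ← holdsForGeneral_restrict_iff]
  -- The two membership conditions agree for every single `g`, so no open set has to be shrunk.
  suffices h : ∀ g : V → Matrix.GeneralLinearGroup (Fin 2) L, _ ↔ _ from
    iff_of_eq (congrArg HoldsForGeneral (_root_.funext fun g => propext (h g)))
  intro g
  refine monomial_mem_initialIdeal_restrict (fun f hf => ?_) (fun f hf => ?_) a
  · refine mem_map_of_commute (rename (BEVar.incl W)).toRingHom (rename (BEVar.incl W)).toRingHom
      (coordChange fun v : W => g v).toRingHom (coordChange g).toRingHom (rename_coordChange g)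
      (fun p hp => ?_) hf
    exact mem_map_of_commute (rename (BEVar.incl W)).toRingHom (rename (BEVar.incl W)).toRingHom
      (MvPolynomial.map (algebraMap K L)) (MvPolynomial.map (algebraMap K L))
      (fun p => (map_rename _ _ p).symm) hJI hp
  · refine mem_map_of_commute (killCompl (BEVar.incl W).injective).toRingHom
      (killCompl (BEVar.incl W).injective).toRingHom
      (coordChange g).toRingHom (coordChange fun v : W => g v).toRingHom (killCompl_coordChange g)
      (fun p hp => ?_) hf
    exact mem_map_of_commute (killCompl (BEVar.incl W).injective).toRingHom
      (killCompl (BEVar.incl W).injective).toRingHom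
      (MvPolynomial.map (algebraMap K L)) (MvPolynomial.map (algebraMap K L))
      (fun p => killCompl_map _ _ p) hIJ hp

end Gin

theorem mainTheorem8 (K : Type*) [Field K] (L : Type*) [Field L] [Infinite L] [Algebra K L]
    (n : ℕ) (G : SimpleGraph (Fin n)) (W : Set (Fin n)) :
    (canonicalInclusion W ''
          (symbolicPolyhedron (initialIdeal (binomialEdgeIdeal K (G.induce W)))).extremePoints ℝ ⊆
        (symbolicPolyhedron (initialIdeal (binomialEdgeIdeal K G))).extremePoints ℝ ∧
      canonicalInclusion W '' symbolicPolyhedron (initialIdeal (binomialEdgeIdeal K (G.induce W))) =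
        vanishingOutside W (symbolicPolyhedron (initialIdeal (binomialEdgeIdeal K G))) ∧
      IsFaceOf (vanishingOutside W (symbolicPolyhedron (initialIdeal (binomialEdgeIdeal K G))))
        (symbolicPolyhedron (initialIdeal (binomialEdgeIdeal K G)))) ∧
    (canonicalInclusion W ''
          (symbolicPolyhedron (gin L (binomialEdgeIdeal K (G.induce W)))).extremePoints ℝ ⊆
        (symbolicPolyhedron (gin L (binomialEdgeIdeal K G))).extremePoints ℝ ∧
      canonicalInclusion W '' symbolicPolyhedron (gin L (binomialEdgeIdeal K (G.induce W))) =
        vanishingOutside W (symbolicPolyhedron (gin L (binomialEdgeIdeal K G))) ∧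
      IsFaceOf (vanishingOutside W (symbolicPolyhedron (gin L (binomialEdgeIdeal K G))))
        (symbolicPolyhedron (gin L (binomialEdgeIdeal K G)))) := by
  have hJI := fun f => rename_mem_binomialEdgeIdeal (W := W) K G (f := f)
  have hIJ := fun f => killCompl_mem_binomialEdgeIdeal (W := W) K G (f := f)
  exact ⟨symbolicPolyhedron_restrict (isMonomialIdeal_initialIdeal _)
      (isMonomialIdeal_initialIdeal _) (monomial_mem_initialIdeal_restrict hJI hIJ),
    symbolicPolyhedron_restrict (isMonomialIdeal_gin _) (isMonomialIdeal_gin _)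
      (monomial_mem_gin_restrict hJI hIJ)⟩
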